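/- There is a universal constant $C>0$ such that the following holds. Let $\delta\in(0,1]$, let $k,m$ be natural numbers with $k\geq 12/\delta^2$ and $m\geq 4$, let $T=(t_{ij})$ be an $m\times k$ matrix of reals, and let $y\in\mathbb{R}^k$ be a vector of Euclidean norm $1$. Then there is a coordinate projection $P:\mathbb{R}^k\to\mathbb{R}^k$ (that is, the orthogonal projection onto the span of $\{e_j\}_{j\in S}$ for some $S\subset\{1,\dots,k\}$, where $e_1,\dots,e_k$ is the standard basis) of rank at most $\delta k$ such that $$C^{-1}\delta^2\min_{1\leq \ell\leq m}|(Ty)_\ell|\;\leq\;\frac{\max_{i,j}|t_{ij}|}{\sqrt{k}}+a,$$ where $a$ is the $\lfloor m/4\rfloor$-th largest (counted with multiplicity) of the $m$ numbers $|(TPy)_1|,\dots,|(TPy)_m|$. -/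

import Mathlib

open scoped Matrix

noncomputable section

/-- The `k`-th largest element (`k = 1, 2, …`, counted with multiplicity) of the finite family
`(a i)_{i ∈ J}` of reals; it is `0` when `k` exceeds the number of elements of `J`. -/
def kthLargest {ι : Type*} (k : ℕ) (J : Finset ι) (a : ι → ℝ) : ℝ :=
  ((J.val.map a).sort (· ≥ ·)).getD (k - 1) 0

/-- `P` is a coordinate projection of `ℝ^ι`: it is the orthogonal projection onto the span of
the standard basis vectors `e_j`, `j ∈ S`, for some set `S` of coordinates. -/
def IsCoordinateProjection {ι : Type*} [Fintype ι]
    (P : EuclideanSpace ℝ ι →ₗ[ℝ] EuclideanSpace ℝ ι) : Prop :=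
  ∃ S : Set ι, ∀ x : EuclideanSpace ℝ ι,
    (∀ j ∈ S, P x j = x j) ∧ (∀ j ∉ S, P x j = 0)

end

/-
Put the coordinates into about `δk/2` blocks of `N ≈ 2/δ` cells. Let `A` be the set of the at most
`δ²k/4` coordinates where `|y_j| > 2‖y‖/(δ√k)`. Keep a uniformly random cell of each block
(ignoring `A`), and independently, with probability `1/2`, all of `A`. For each row the resulting
sum of the `t_ij y_j` is a two-valued variable plus a sum of independent variables that are small
unless `max|t_ij| ‖y‖/√k` already dominates, in which case `P = 0` works. Its fourth moment is
therefore at most `3.24` times the square of its second moment, which is at least of order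
`((Ty)_i/N)²`, and the Paley–Zygmund inequality makes the sum at least of order `δ|(Ty)_i|` with
probability at least `1/4`. Averaging over the rows, some choice does this for a quarter of them.
-/

section

open Finset
open scoped BigOperators

section Moments

variable {Ω Ω' : Type*} [Fintype Ω] [Fintype Ω']

theorem expect_prod_add_pow (X : Ω → ℝ) (Y : Ω' → ℝ) (n : ℕ) :
    𝔼 p : Ω × Ω', (X p.1 + Y p.2) ^ n =
      ∑ i ∈ range (n + 1), (𝔼 ω, X ω ^ i) * (𝔼 ω, Y ω ^ (n - i)) * n.choose i := by
  simp only [add_pow, expect_sum_comm, Fintype.expect_mul_expect, ← expect_mul]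
  refine sum_congr rfl fun i _ => ?_
  congr 1
  exact expect_product univ univ fun p : Ω × Ω' => X p.1 ^ i * Y p.2 ^ (n - i)

theorem expect_prod_add_sq [Nonempty Ω] [Nonempty Ω'] (X : Ω → ℝ) {Y : Ω' → ℝ}
    (hY : 𝔼 ω, Y ω = 0) :
    𝔼 p : Ω × Ω', (X p.1 + Y p.2) ^ 2 = (𝔼 ω, X ω ^ 2) + 𝔼 ω, Y ω ^ 2 := by
  rw [expect_prod_add_pow]
  simp [sum_range_succ, hY, add_comm]

theorem expect_prod_add_pow_three [Nonempty Ω] [Nonempty Ω'] (X : Ω → ℝ) {Y : Ω' → ℝ}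
    (hY : 𝔼 ω, Y ω = 0) :
    𝔼 p : Ω × Ω', (X p.1 + Y p.2) ^ 3 =
      (𝔼 ω, X ω ^ 3) + 3 * (𝔼 ω, X ω) * (𝔼 ω, Y ω ^ 2) + 𝔼 ω, Y ω ^ 3 := by
  rw [expect_prod_add_pow]
  simp [sum_range_succ, Nat.choose, hY]
  ring

theorem expect_prod_add_pow_four [Nonempty Ω] [Nonempty Ω'] (X : Ω → ℝ) {Y : Ω' → ℝ}
    (hY : 𝔼 ω, Y ω = 0) :
    𝔼 p : Ω × Ω', (X p.1 + Y p.2) ^ 4 =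
      (𝔼 ω, X ω ^ 4) + 6 * (𝔼 ω, X ω ^ 2) * (𝔼 ω, Y ω ^ 2) + 4 * (𝔼 ω, X ω) * (𝔼 ω, Y ω ^ 3) +
        𝔼 ω, Y ω ^ 4 := by
  rw [expect_prod_add_pow]
  simp [sum_range_succ, Nat.choose, hY]
  ring

theorem paley_zygmund [Nonempty Ω] (Z : Ω → ℝ) {θ : ℝ} (hθ0 : 0 ≤ θ) (hθ1 : θ ≤ 1)
    (hZ : 0 ≤ 𝔼 ω, Z ω) :
    ((1 - θ) * 𝔼 ω, Z ω) ^ 2 ≤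
      (dens {ω | θ * 𝔼 ω', Z ω' ≤ Z ω} : ℝ) * 𝔼 ω, Z ω ^ 2 := by
  classical
  set G : Finset Ω := {ω | θ * 𝔼 ω', Z ω' ≤ Z ω} with hG
  let χ : Ω → ℝ := fun ω => if ω ∈ G then 1 else 0
  have hχ : 𝔼 ω, χ ω ^ 2 = (G.dens : ℝ) := by
    simp [χ, nnratCast_dens, Fintype.expect_eq_sum_div_card]
  have hpoint : ∀ ω, Z ω ≤ θ * 𝔼 ω', Z ω' + χ ω * Z ω := fun ω => by
    by_cases hω : θ * 𝔼 ω', Z ω' ≤ Z ω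
    · simp only [χ, hG, mem_filter_univ, hω, if_true, one_mul]
      linarith [mul_nonneg hθ0 hZ]
    · simp only [χ, hG, mem_filter_univ, hω, if_false, zero_mul, add_zero]
      exact (not_le.1 hω).le
  have hmain : (1 - θ) * 𝔼 ω, Z ω ≤ 𝔼 ω, χ ω * Z ω := by
    have h := expect_le_expect fun ω (_ : ω ∈ univ) => hpoint ω
    rw [expect_add_distrib, Fintype.expect_const] at h
    linarith
  calc ((1 - θ) * 𝔼 ω, Z ω) ^ 2 ≤ (𝔼 ω, χ ω * Z ω) ^ 2 :=
        pow_le_pow_left₀ (mul_nonneg (sub_nonneg.2 hθ1) hZ) hmain 2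
    _ ≤ (𝔼 ω, χ ω ^ 2) * 𝔼 ω, Z ω ^ 2 := expect_mul_sq_le_sq_mul_sq _ _ _
    _ = G.dens * 𝔼 ω, Z ω ^ 2 := by rw [hχ]

-- The constant is `3.24 = 4 * (1 - 1 / 10) ^ 2`.
theorem quarter_le_dens_of_expect_pow_four_le [Nonempty Ω] {X : Ω → ℝ}
    (hX : 0 < 𝔼 ω, X ω ^ 2) (hX4 : 𝔼 ω, X ω ^ 4 ≤ 3.24 * (𝔼 ω, X ω ^ 2) ^ 2) :
    (1 / 4 : ℝ) ≤ dens {ω | 1 / 10 * 𝔼 ω', X ω' ^ 2 ≤ X ω ^ 2} := by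
  have hpz := paley_zygmund (fun ω => X ω ^ 2) (θ := 1 / 10) (by norm_num) (by norm_num) hX.le
  simp only [← pow_mul, Nat.reduceMul] at hpz
  have hdens := hpz.trans (mul_le_mul_of_nonneg_left hX4 (NNRat.cast_nonneg _))
  refine le_of_mul_le_mul_right ?_ (by positivity : 0 < 3.24 * (𝔼 ω, X ω ^ 2) ^ 2)
  linarith

/-- `X` has mean zero under the uniform measure, and its third and fourth moments are bounded as for
a sum of independent centred variables of absolute value at most `c`. The constants are such that
adding independent variables preserves the bounds. -/
structure CentredMomentBound (X : Ω → ℝ) (c : ℝ) : Prop where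
  expect_eq_zero : 𝔼 ω, X ω = 0
  abs_expect_pow_three_le : |𝔼 ω, X ω ^ 3| ≤ c * 𝔼 ω, X ω ^ 2
  expect_pow_four_le : 𝔼 ω, X ω ^ 4 ≤ 3 * (𝔼 ω, X ω ^ 2) ^ 2 + c ^ 2 * 𝔼 ω, X ω ^ 2

namespace CentredMomentBound

variable {X : Ω → ℝ} {Y : Ω' → ℝ} {c : ℝ}

theorem of_abs_le (hX : 𝔼 ω, X ω = 0) (hc : ∀ ω, |X ω| ≤ c) : CentredMomentBound X c where
  expect_eq_zero := hX
  abs_expect_pow_three_le := by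
    refine (abs_expect_le _ _).trans ?_
    rw [mul_expect]
    refine expect_le_expect fun ω _ => ?_
    calc |X ω ^ 3| = |X ω| * X ω ^ 2 := by rw [abs_pow, pow_succ', sq_abs]
      _ ≤ c * X ω ^ 2 := by gcongr; exact hc ω
  expect_pow_four_le := by
    refine le_add_of_nonneg_of_le (by positivity) ?_
    rw [mul_expect]
    refine expect_le_expect fun ω _ => ?_
    calc X ω ^ 4 = |X ω| ^ 2 * X ω ^ 2 := by rw [sq_abs]; ring
      _ ≤ c ^ 2 * X ω ^ 2 := by gcongr; exact hc ω

theorem comp_equiv (hX : CentredMomentBound X c) (e : Ω' ≃ Ω) :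
    CentredMomentBound (fun ω => X (e ω)) c := by
  have hmoment : ∀ n : ℕ, 𝔼 ω, X (e ω) ^ n = 𝔼 ω, X ω ^ n := fun n =>
    Fintype.expect_equiv e _ _ fun _ => rfl
  refine ⟨?_, ?_, ?_⟩
  · simpa using (hmoment 1).trans (by simpa using hX.expect_eq_zero)
  · simpa only [hmoment] using hX.abs_expect_pow_three_le
  · simpa only [hmoment] using hX.expect_pow_four_le

theorem prod_add [Nonempty Ω] [Nonempty Ω'] (hX : CentredMomentBound X c)
    (hY : CentredMomentBound Y c) :
    CentredMomentBound (fun p : Ω × Ω' => X p.1 + Y p.2) c where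
  expect_eq_zero := by
    simpa [sum_range_succ, hX.expect_eq_zero, hY.expect_eq_zero] using expect_prod_add_pow X Y 1
  abs_expect_pow_three_le := by
    rw [expect_prod_add_sq X hY.expect_eq_zero, expect_prod_add_pow_three X hY.expect_eq_zero,
      hX.expect_eq_zero, mul_zero, zero_mul, add_zero, mul_add]
    exact (abs_add_le _ _).trans
      (add_le_add hX.abs_expect_pow_three_le hY.abs_expect_pow_three_le)
  expect_pow_four_le := by
    rw [expect_prod_add_sq X hY.expect_eq_zero, expect_prod_add_pow_four X hY.expect_eq_zero,
      hX.expect_eq_zero]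
    linarith [hX.expect_pow_four_le, hY.expect_pow_four_le]

theorem sum {β : Type*} [Fintype β] [Nonempty β] {q : ℕ} {w : Fin q → β → ℝ}
    (hw : ∀ i, CentredMomentBound (w i) c) :
    CentredMomentBound (fun g : Fin q → β => ∑ i, w i (g i)) c := by
  induction q with
  | zero => exact ⟨by simp, by simp, by simp⟩
  | succ q ih =>
    simp only [Fin.sum_univ_succ]
    exact ((hw 0).prod_add (ih fun i => hw i.succ)).comp_equiv
      (Fin.consEquiv fun _ : Fin (q + 1) => β).symm

theorem expect_add_pow_four_le [Nonempty Ω] [Nonempty Ω'] {f : Ω' → ℝ} {ε : ℝ}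
    (hX : CentredMomentBound X c) (hf : 𝔼 ω, f ω ^ 4 ≤ 3 * (𝔼 ω, f ω ^ 2) ^ 2) (hε : 0 ≤ ε)
    (hc : c ^ 2 ≤ ε ^ 2 * 𝔼 p : Ω' × Ω, (f p.1 + X p.2) ^ 2) :
    𝔼 p : Ω' × Ω, (f p.1 + X p.2) ^ 4 ≤
      (3 + 4 * ε + ε ^ 2) * (𝔼 p : Ω' × Ω, (f p.1 + X p.2) ^ 2) ^ 2 := by
  rw [expect_prod_add_sq f hX.expect_eq_zero] at hc ⊢
  rw [expect_prod_add_pow_four f hX.expect_eq_zero]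
  set F := 𝔼 ω, f ω ^ 2
  set v := 𝔼 ω, X ω ^ 2
  have hF : 0 ≤ F := expect_nonneg fun ω _ => sq_nonneg (f ω)
  have hv : 0 ≤ v := expect_nonneg fun ω _ => sq_nonneg (X ω)
  have hmean : (𝔼 ω, f ω) ^ 2 ≤ F := by
    simpa using expect_mul_sq_le_sq_mul_sq univ f fun _ => 1
  have hshift : |𝔼 ω, f ω| * c ≤ ε * (F + v) := by
    refine abs_le_of_sq_le_sq' ?_ (by positivity) |>.2
    calc (|𝔼 ω, f ω| * c) ^ 2 = (𝔼 ω, f ω) ^ 2 * c ^ 2 := by rw [mul_pow, sq_abs]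
      _ ≤ (F + v) * (ε ^ 2 * (F + v)) := by gcongr; linarith
      _ = (ε * (F + v)) ^ 2 := by ring
  have hthird : (𝔼 ω, f ω) * 𝔼 ω, X ω ^ 3 ≤ ε * (F + v) ^ 2 := by
    calc (𝔼 ω, f ω) * 𝔼 ω, X ω ^ 3 ≤ |𝔼 ω, f ω| * |𝔼 ω, X ω ^ 3| :=
          (le_abs_self _).trans (abs_mul _ _).le
      _ ≤ |𝔼 ω, f ω| * (c * v) := by gcongr; exact hX.abs_expect_pow_three_le
      _ = |𝔼 ω, f ω| * c * v := by ring
      _ ≤ ε * (F + v) * (F + v) := by gcongr; linarith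
      _ = ε * (F + v) ^ 2 := by ring
  have hfourth : c ^ 2 * v ≤ ε ^ 2 * (F + v) ^ 2 := by
    calc c ^ 2 * v ≤ ε ^ 2 * (F + v) * (F + v) := by gcongr; linarith
      _ = ε ^ 2 * (F + v) ^ 2 := by ring
  linarith [hX.expect_pow_four_le]

end CentredMomentBound

end Moments

section Choice

theorem expect_bool (f : Bool → ℝ) : 𝔼 s, f s = (f true + f false) / 2 := by
  rw [Fintype.expect_eq_sum_div_card, Fintype.sum_bool, Fintype.card_bool, Nat.cast_ofNat]

theorem expect_bool_pow_four_le (f : Bool → ℝ) : 𝔼 s, f s ^ 4 ≤ 2 * (𝔼 s, f s ^ 2) ^ 2 := by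
  rw [expect_bool, expect_bool]
  linarith [mul_nonneg (sq_nonneg (f true)) (sq_nonneg (f false))]

-- A fixed `α` could cancel `μ` without cancelling `N * μ`; present with probability `1 / 2`, it
-- cannot, as `α + μ` and `μ` are not both small.
theorem sq_add_mul_le_expect_bool {N : ℝ} (hN : 1 ≤ N) (α μ : ℝ) :
    (α + N * μ) ^ 2 ≤ N ^ 2 * (2 * 𝔼 s : Bool, ((if s then α else 0) + μ) ^ 2) := by
  rw [expect_bool, if_pos rfl, if_neg Bool.false_ne_true]
  linarith [sq_nonneg ((N - 1) * (α + μ) - μ),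
    mul_nonneg (sub_nonneg.2 hN) (add_nonneg (sq_nonneg (α + μ)) (sq_nonneg μ))]

theorem quarter_le_dens_random_choice {β : Type*} [Fintype β] [Nonempty β] {q : ℕ}
    {w : Fin q → β → ℝ} {h : ℝ} (α : ℝ) (hw : ∀ i r, |w i r| ≤ h) (h0 : 0 ≤ h)
    (hpos : 0 < |α + ∑ i, ∑ r, w i r|)
    (hsmall : 60 * h ≤ |α + ∑ i, ∑ r, w i r| / Fintype.card β) :
    (1 / 4 : ℝ) ≤ dens {ω : Bool × (Fin q → β) |
      |α + ∑ i, ∑ r, w i r| / (5 * Fintype.card β) ≤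
        |(if ω.1 then α else 0) + ∑ i, w i (ω.2 i)|} := by
  have hN : (1 : ℝ) ≤ Fintype.card β := by exact_mod_cast Fintype.card_pos (α := β)
  set N : ℝ := (Fintype.card β : ℝ) with hNβ
  set τ := α + ∑ i, ∑ r, w i r with hτ
  let μ : Fin q → ℝ := fun i => 𝔼 r, w i r
  let f : Bool → ℝ := fun s => (if s then α else 0) + ∑ i, μ i
  let S : (Fin q → β) → ℝ := fun g => ∑ i, (w i (g i) - μ i)
  have hchoice : ∀ ω : Bool × (Fin q → β),
      (if ω.1 then α else 0) + ∑ i, w i (ω.2 i) = f ω.1 + S ω.2 := fun ω => by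
    simp only [f, S, sum_sub_distrib]
    ring
  have hμ : ∀ i, |μ i| ≤ h := fun i =>
    (abs_expect_le _ _).trans (expect_le univ_nonempty fun r _ => hw i r)
  have hS : CentredMomentBound S (2 * h) :=
    .sum (w := fun i r => w i r - μ i) fun i => .of_abs_le (by simp [μ, expect_sub_distrib])
      fun r => (abs_sub _ _).trans (by linarith [hw i r, hμ i])
  have htotal : τ = α + N * ∑ i, μ i := by
    simp only [hτ, μ, hNβ, mul_sum, Fintype.card_mul_expect]
  have hτX : (|τ| / N) ^ 2 ≤ 2 * 𝔼 p : Bool × (Fin q → β), (f p.1 + S p.2) ^ 2 := by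
    rw [expect_prod_add_sq f hS.expect_eq_zero, div_pow, sq_abs, div_le_iff₀' (by positivity),
      htotal]
    refine (sq_add_mul_le_expect_bool hN _ _).trans ?_
    gcongr
    exact le_add_of_nonneg_right (expect_nonneg fun g _ => sq_nonneg _)
  have hτN : 0 < |τ| / N := by positivity
  have hX2 : 0 < 𝔼 p : Bool × (Fin q → β), (f p.1 + S p.2) ^ 2 := by
    linarith [pow_pos hτN 2]
  have hX4 := hS.expect_add_pow_four_le (ε := 1 / 20)
    ((expect_bool_pow_four_le f).trans (by gcongr; norm_num)) (by norm_num)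
    (by linarith [pow_le_pow_left₀ (by positivity) hsmall 2])
  refine (quarter_le_dens_of_expect_pow_four_le hX2 (hX4.trans (by gcongr; norm_num))).trans ?_
  refine NNRat.cast_mono (dens_le_dens (monotone_filter_right _ fun ω _ hω => ?_))
  rw [hchoice, ← abs_of_nonneg (by positivity : 0 ≤ |τ| / (5 * N)), ← sq_le_sq]
  calc (|τ| / (5 * N)) ^ 2 = 1 / 25 * (|τ| / N) ^ 2 := by ring
    _ ≤ (f ω.1 + S ω.2) ^ 2 := by linarith

end Choice

section Selection

variable {κ β : Type*} [Fintype κ] [DecidableEq κ] [DecidableEq β] {q : ℕ}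

/-- The coordinates kept by the choice `ω`. The injection `e` arranges the coordinates into `q`
blocks with cells indexed by `β`; from each block the coordinate of `Aᶜ` in the cell chosen by
`ω.2` is kept (if that cell holds one), and `ω.1` decides whether all of `A` is kept. -/
def selection (e : κ → Fin q × β) (A : Finset κ) (ω : Bool × (Fin q → β)) : Finset κ :=
  (if ω.1 then A else ∅) ∪ {j ∈ Aᶜ | ω.2 (e j).1 = (e j).2}

theorem card_selection_le {e : κ → Fin q × β} (he : Function.Injective e) (A : Finset κ)
    (ω : Bool × (Fin q → β)) : #(selection e A ω) ≤ #A + q := by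
  refine (card_union_le _ _).trans (Nat.add_le_add ?_ ?_)
  · split_ifs <;> simp
  · have hinj : Set.InjOn (fun j => (e j).1)
        ({j ∈ Aᶜ | ω.2 (e j).1 = (e j).2} : Finset κ) := fun j hj j' hj' hblock => by
      have hj := (mem_filter.1 hj).2
      have hj' := (mem_filter.1 hj').2
      exact he (Prod.ext hblock (hj.symm.trans ((congrArg ω.2 hblock).trans hj')))
    simpa using card_le_card_of_injOn _ (fun _ _ => mem_univ _) hinj

theorem sum_selection (e : κ → Fin q × β) (A : Finset κ) (ω : Bool × (Fin q → β)) (z : κ → ℝ) :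
    ∑ j ∈ selection e A ω, z j =
      (if ω.1 then ∑ j ∈ A, z j else 0) + ∑ i, ∑ j ∈ Aᶜ with e j = (i, ω.2 i), z j := by
  have hdisj : Disjoint (if ω.1 then A else ∅) {j ∈ Aᶜ | ω.2 (e j).1 = (e j).2} := by
    refine Disjoint.mono (b := A) ?_ (filter_subset _ _) disjoint_compl_right
    split_ifs <;> simp
  have hblocks : ∑ j ∈ Aᶜ with ω.2 (e j).1 = (e j).2, z j =
      ∑ i, ∑ j ∈ Aᶜ with e j = (i, ω.2 i), z j := by
    rw [← sum_fiberwise _ fun j => (e j).1]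
    refine sum_congr rfl fun i _ => sum_congr ?_ fun _ _ => rfl
    ext j
    simp only [mem_filter, Prod.ext_iff]
    grind
  rw [selection, sum_union hdisj, hblocks]
  split_ifs <;> simp

theorem sum_add_sum_cells [Fintype β] (e : κ → Fin q × β) (A : Finset κ) (z : κ → ℝ) :
    ∑ j ∈ A, z j + ∑ i, ∑ r, ∑ j ∈ Aᶜ with e j = (i, r), z j = ∑ j, z j := by
  rw [← sum_add_sum_compl A, ← sum_fiberwise Aᶜ e, Fintype.sum_prod_type]

theorem abs_sum_cell_le {e : κ → Fin q × β} (he : Function.Injective e) {A : Finset κ}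
    {z : κ → ℝ} {h : ℝ} (h0 : 0 ≤ h) (hz : ∀ j ∉ A, |z j| ≤ h) (c : Fin q × β) :
    |∑ j ∈ Aᶜ with e j = c, z j| ≤ h := by
  have hcard : #{j ∈ Aᶜ | e j = c} ≤ 1 := card_le_one.2 fun j hj j' hj' =>
    he ((mem_filter.1 hj).2.trans (mem_filter.1 hj').2.symm)
  calc |∑ j ∈ Aᶜ with e j = c, z j| ≤ ∑ j ∈ Aᶜ with e j = c, |z j| := abs_sum_le_sum_abs _ _
    _ ≤ #{j ∈ Aᶜ | e j = c} • h :=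
        sum_le_card_nsmul _ _ _ fun j hj => hz j (mem_compl.1 (mem_filter.1 hj).1)
    _ ≤ 1 • h := nsmul_le_nsmul_left h0 hcard
    _ = h := one_nsmul h

end Selection

section Existence

theorem exists_mul_card_le_card_of_le_dens {Ω ι : Type*} [Fintype Ω] [Nonempty Ω] [Fintype ι]
    {R : ι → Ω → Prop} [∀ i ω, Decidable (R i ω)] {p : ℝ}
    (hp : ∀ i, p ≤ dens {ω | R i ω}) : ∃ ω, p * Fintype.card ι ≤ #{i | R i ω} := by
  have hcount : p * Fintype.card ι ≤ 𝔼 ω, (#{i | R i ω} : ℝ) := by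
    calc p * Fintype.card ι = ∑ _i : ι, p := by simp [mul_comm]
      _ ≤ ∑ i, (dens {ω | R i ω} : ℝ) := sum_le_sum fun i _ => hp i
      _ = 𝔼 ω, (#{i | R i ω} : ℝ) := by
        simp only [nnratCast_dens, Fintype.expect_eq_sum_div_card, ← sum_div, ← Nat.cast_sum]
        congr 2
        exact sum_card_bipartiteAbove_eq_sum_card_bipartiteBelow R
  obtain ⟨ω, -, hω⟩ := exists_le_of_le_expect univ_nonempty hcount
  exact ⟨ω, hω⟩

variable {ι κ : Type*} [Fintype κ]

theorem exists_finset_many_large_sums [Fintype ι] {q N : ℕ} (hN : 0 < N)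
    (hκ : Fintype.card κ ≤ q * N) (z : ι → κ → ℝ) (A : Finset κ) {h b : ℝ} (h0 : 0 ≤ h)
    (hb : 0 < b) (hz : ∀ i, ∀ j ∉ A, |z i j| ≤ h) (hbz : ∀ i, b ≤ |∑ j, z i j|)
    (hsmall : 60 * h ≤ b / N) :
    ∃ S : Finset κ, #S ≤ #A + q ∧
      (1 / 4 : ℝ) * Fintype.card ι ≤ #{i | b / (5 * N) ≤ |∑ j ∈ S, z i j|} := by
  classical
  have : Nonempty (Fin N) := ⟨⟨0, hN⟩⟩
  obtain ⟨e⟩ : Nonempty (κ ↪ Fin q × Fin N) :=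
    Function.Embedding.nonempty_of_card_le (by simpa using hκ)
  have hdens : ∀ i, (1 / 4 : ℝ) ≤ dens {ω : Bool × (Fin q → Fin N) |
      b / (5 * N) ≤ |∑ j ∈ selection e A ω, z i j|} := fun i => by
    have hchoice := quarter_le_dens_random_choice (∑ j ∈ A, z i j)
      (fun a r => abs_sum_cell_le e.injective h0 (hz i) (a, r)) h0
    simp only [sum_add_sum_cells, ← sum_selection, Fintype.card_fin] at hchoice
    refine (hchoice (hb.trans_le (hbz i)) (hsmall.trans (by gcongr; exact hbz i))).trans ?_
    refine NNRat.cast_mono (dens_le_dens (monotone_filter_right _ fun ω _ hω => le_trans ?_ hω))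
    gcongr
    exact hbz i
  obtain ⟨ω, hω⟩ := exists_mul_card_le_card_of_le_dens hdens
  exact ⟨selection e A ω, card_selection_le e.injective A ω, hω⟩

theorem card_lt_abs_mul_sq_le (y : EuclideanSpace ℝ κ) {s : ℝ} (hs : 0 ≤ s) :
    #{j | s < |y j|} * s ^ 2 ≤ ‖y‖ ^ 2 := by
  rw [EuclideanSpace.real_norm_sq_eq, ← nsmul_eq_mul]
  calc #{j | s < |y j|} • s ^ 2 ≤ ∑ j with s < |y j|, y j ^ 2 :=
        card_nsmul_le_sum _ _ _ fun j hj => by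
          rw [← sq_abs (y j)]
          exact pow_le_pow_left₀ hs (mem_filter.1 hj).2.le 2
    _ ≤ ∑ j, y j ^ 2 :=
        sum_le_sum_of_subset_of_nonneg (filter_subset _ _) fun _ _ _ => sq_nonneg _

theorem card_coord_gt_le {y : EuclideanSpace ℝ κ} (hy : y ≠ 0) {δ : ℝ} (hδ : 0 < δ) :
    (#{j | 2 * ‖y‖ / (δ * √(Fintype.card κ)) < |y j|} : ℝ) ≤ δ ^ 2 * Fintype.card κ / 4 := by
  have hκ : (0 : ℝ) < Fintype.card κ := by
    obtain ⟨j, -⟩ : ∃ j, y j ≠ 0 := by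
      by_contra! hzero
      exact hy (PiLp.ext hzero)
    exact_mod_cast Fintype.card_pos_iff.2 ⟨j⟩
  have : 0 < ‖y‖ := norm_pos_iff.2 hy
  have hcard := card_lt_abs_mul_sq_le y
    (s := 2 * ‖y‖ / (δ * √(Fintype.card κ))) (by positivity)
  have hsq : (2 * ‖y‖ / (δ * √(Fintype.card κ))) ^ 2 =
      ‖y‖ ^ 2 / (δ ^ 2 * Fintype.card κ / 4) := by
    rw [div_pow, mul_pow, mul_pow, Real.sq_sqrt hκ.le]
    ring
  rwa [hsq, mul_div_assoc', div_le_iff₀ (by positivity), mul_comm (‖y‖ ^ 2),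
    mul_le_mul_iff_left₀ (by positivity)] at hcard

theorem abs_mulVec_le {T : Matrix ι κ ℝ} {M : ℝ} {i : ι} (hT : ∀ j, |T i j| ≤ M) (hM : 0 ≤ M)
    (y : EuclideanSpace ℝ κ) :
    |(T *ᵥ y.ofLp) i| ≤ M * (√(Fintype.card κ) * ‖y‖) := by
  have hl1 : ∑ j, |y j| ≤ √(Fintype.card κ) * ‖y‖ := by
    refine abs_le_of_sq_le_sq' ?_ (by positivity) |>.2
    rw [mul_pow, Real.sq_sqrt (Nat.cast_nonneg _), EuclideanSpace.real_norm_sq_eq]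
    simpa using sq_sum_le_card_mul_sum_sq (s := univ) (f := fun j => |y j|)
  calc |(T *ᵥ y.ofLp) i| ≤ ∑ j, |T i j * y j| := abs_sum_le_sum_abs _ _
    _ ≤ ∑ j, M * |y j| := sum_le_sum fun j _ => by
        rw [abs_mul]
        gcongr
        exact hT j
    _ = M * ∑ j, |y j| := (mul_sum _ _ _).symm
    _ ≤ M * (√(Fintype.card κ) * ‖y‖) := by gcongr

theorem one_lt_mul_card_of_lt {T : Matrix ι κ ℝ} {y : EuclideanSpace ℝ κ} {M a b : ℝ} {i : ι}
    (hT : ∀ j, |T i j| ≤ M) (hM : 0 ≤ M) (ha : 0 ≤ a) (hb : b ≤ |(T *ᵥ y.ofLp) i|)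
    (hlt : M * ‖y‖ / √(Fintype.card κ) < a * b) : 1 < a * Fintype.card κ := by
  set u := M * ‖y‖ / √(Fintype.card κ)
  have : 0 ≤ u := by positivity
  have hbu : b ≤ Fintype.card κ * u := by
    calc b ≤ M * (√(Fintype.card κ) * ‖y‖) := hb.trans (abs_mulVec_le hT hM y)
      _ = Fintype.card κ / √(Fintype.card κ) * (M * ‖y‖) := by rw [Real.div_sqrt]; ring
      _ = Fintype.card κ * u := by ring
  by_contra! hle
  refine hlt.not_ge ?_
  calc a * b ≤ a * (Fintype.card κ * u) := by gcongr
    _ = a * Fintype.card κ * u := by ring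
    _ ≤ 1 * u := by gcongr
    _ = u := one_mul u

theorem mul_ceil_two_div_le {δ : ℝ} (hδ0 : 0 < δ) (hδ1 : δ ≤ 1) : δ * ⌈2 / δ⌉₊ ≤ 3 :=
  calc δ * ⌈2 / δ⌉₊ ≤ δ * (2 / δ + 1) := by
        gcongr
        exact (Nat.ceil_lt_add_one (by positivity)).le
    _ = 2 + δ := by field_simp
    _ ≤ 3 := by linarith

theorem cast_div_ceil_two_div_le {δ : ℝ} (hδ : 0 < δ) (k : ℕ) :
    ((k / ⌈2 / δ⌉₊ : ℕ) : ℝ) ≤ δ * k / 2 :=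
  calc ((k / ⌈2 / δ⌉₊ : ℕ) : ℝ) ≤ k / ⌈2 / δ⌉₊ := Nat.cast_div_le
    _ ≤ k / (2 / δ) := by
        gcongr
        exact Nat.le_ceil _
    _ = δ * k / 2 := by field_simp

theorem exists_finset_card_le_many_large_mulVec [Fintype ι] [Nonempty ι] {δ : ℝ} (hδ0 : 0 < δ)
    (hδ1 : δ ≤ 1) {T : Matrix ι κ ℝ} {y : EuclideanSpace ℝ κ} {M b : ℝ}
    (hT : ∀ i j, |T i j| ≤ M) (hM : 0 ≤ M) (hb : ∀ i, b ≤ |(T *ᵥ y.ofLp) i|)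
    (hlt : M * ‖y‖ / √(Fintype.card κ) < 360⁻¹ * δ ^ 2 * b) :
    ∃ S : Finset κ, (#S : ℝ) ≤ δ * Fintype.card κ ∧
      (1 / 4 : ℝ) * Fintype.card ι ≤ #{i | δ * b / 15 ≤ |∑ j ∈ S, T i j * y j|} := by
  obtain ⟨i₀⟩ := ‹Nonempty ι›
  have hk := one_lt_mul_card_of_lt (hT i₀) hM (by positivity) (hb i₀) hlt
  set k := Fintype.card κ
  have hk0 : (0 : ℝ) < k :=
    pos_of_mul_pos_right (zero_lt_one.trans hk) (by positivity)
  have hb0 : 0 < b := pos_of_mul_pos_right (lt_of_le_of_lt (by positivity) hlt) (by positivity)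
  have hy : 0 < ‖y‖ := norm_pos_iff.2 fun hy0 => hb0.not_ge (by simpa [hy0] using hb i₀)
  set s : ℝ := 2 * ‖y‖ / (δ * √k) with hs
  set A : Finset κ := {j | s < |y j|} with hA
  set N := ⌈2 / δ⌉₊
  have hN0 : 0 < N := Nat.ceil_pos.2 (by positivity)
  have hNpos : (0 : ℝ) < N := Nat.cast_pos.2 hN0
  have hN3 : δ * N ≤ 3 := mul_ceil_two_div_le hδ0 hδ1
  have hsmall : 60 * (M * s) ≤ b / N := by
    rw [le_div_iff₀ hNpos]
    calc 60 * (M * s) * N = 120 * (M * ‖y‖ / √k) * (δ * N) / δ ^ 2 := by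
          rw [hs]
          field_simp
          ring
      _ ≤ 120 * (360⁻¹ * δ ^ 2 * b) * 3 / δ ^ 2 := by gcongr
      _ = b := by field_simp; norm_num
  obtain ⟨S, hScard, hS⟩ := exists_finset_many_large_sums (q := k / N + 1) hN0
    (by rw [mul_comm]; exact (Nat.lt_mul_div_succ k hN0).le) (fun i j => T i j * y j) A
    (by positivity) hb0 (fun i j hj => by
      rw [abs_mul]
      gcongr
      · exact hT i j
      · simpa [hA] using hj) hb hsmall
  refine ⟨S, ?_, hS.trans ?_⟩
  · have hScard' : (#S : ℝ) ≤ #A + ((k / N : ℕ) + 1) := by exact_mod_cast hScard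
    have hδk : δ ^ 2 * k ≤ δ * k := by
      gcongr
      exact pow_le_of_le_one hδ0.le hδ1 two_ne_zero
    have hA' : (#A : ℝ) ≤ δ ^ 2 * k / 4 := card_coord_gt_le (norm_pos_iff.1 hy) hδ0
    linarith [cast_div_ceil_two_div_le hδ0 k]
  · refine Nat.cast_le.2 (card_le_card (monotone_filter_right _ fun i _ hi => le_trans ?_ hi))
    rw [le_div_iff₀ (by positivity)]
    calc δ * b / 15 * (5 * N) = δ * N * b / 3 := by ring
      _ ≤ 3 * b / 3 := by gcongr
      _ = b := by ring

end Existence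

section Order

theorem le_kthLargest {ι : Type*} {J : Finset ι} {a : ι → ℝ} {t : ℝ} {n : ℕ} (hn : 0 < n)
    (h : n ≤ #{i ∈ J | t ≤ a i}) : t ≤ kthLargest n J a := by
  classical
  unfold kthLargest
  set L := (J.val.map a).sort (· ≥ ·) with hL
  have hcount : n ≤ L.countP (t ≤ ·) := by
    rw [← Multiset.coe_countP, hL, Multiset.sort_eq, Multiset.countP_map]
    exact h
  have hlen : n - 1 < L.length := by
    have := hcount.trans List.countP_le_length
    lia
  rw [List.getD_eq_getElem _ _ hlen]
  by_contra! hlt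
  have hdrop : (L.drop (n - 1)).countP (t ≤ ·) = 0 := by
    have hsorted : (L.drop (n - 1)).Pairwise (· ≥ ·) := (Multiset.pairwise_sort _ _).drop
    rw [List.drop_eq_getElem_cons hlen] at hsorted ⊢
    simp only [List.countP_eq_zero, List.mem_cons, forall_eq_or_imp, decide_eq_true_eq, not_le]
    exact ⟨hlt, fun x hx => (List.rel_of_pairwise_cons hsorted hx).trans_lt hlt⟩
  have htake : (L.take (n - 1)).countP (t ≤ ·) ≤ n - 1 :=
    List.countP_le_length.trans (List.length_take_le _ _)
  rw [← List.take_append_drop (n - 1) L, List.countP_append, hdrop] at hcount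
  lia

end Order

section Projection

variable {κ : Type*} [Fintype κ] [DecidableEq κ]

/-- The orthogonal projection onto the span of the basis vectors `e_j`, `j ∈ S`, as a diagonal
`0`-`1` matrix. -/
noncomputable def coordinateProjection (S : Finset κ) :
    EuclideanSpace ℝ κ →ₗ[ℝ] EuclideanSpace ℝ κ :=
  Matrix.toEuclideanLin (Matrix.diagonal fun j => if j ∈ S then 1 else 0)

theorem coordinateProjection_apply (S : Finset κ) (x : EuclideanSpace ℝ κ) (j : κ) :
    coordinateProjection S x j = if j ∈ S then x j else 0 := by
  simp [coordinateProjection, Matrix.mulVec_diagonal]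

theorem isCoordinateProjection_coordinateProjection (S : Finset κ) :
    IsCoordinateProjection (coordinateProjection S) :=
  ⟨S, fun x => ⟨fun j hj => by simp_all [coordinateProjection_apply],
    fun j hj => by simp_all [coordinateProjection_apply]⟩⟩

theorem finrank_range_coordinateProjection (S : Finset κ) :
    Module.finrank ℝ (LinearMap.range (coordinateProjection S)) = #S := by
  rw [coordinateProjection, Matrix.toEuclideanLin_eq_toLin_orthonormal,
    ← Matrix.rank_eq_finrank_range_toLin, Matrix.rank_diagonal]
  simp

theorem mulVec_coordinateProjection {ι : Type*} (T : Matrix ι κ ℝ) (S : Finset κ)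
    (y : EuclideanSpace ℝ κ) (i : ι) :
    (T *ᵥ (coordinateProjection S y).ofLp) i = ∑ j ∈ S, T i j * y j := by
  simp [Matrix.mulVec, dotProduct, coordinateProjection_apply]

end Projection

theorem lemmal_general {ι κ : Type*} [Fintype ι] [Fintype κ] {δ : ℝ} (hδ0 : 0 < δ) (hδ1 : δ ≤ 1)
    (hι : 4 ≤ Fintype.card ι) (T : Matrix ι κ ℝ) (y : EuclideanSpace ℝ κ) :
    ∃ P : EuclideanSpace ℝ κ →ₗ[ℝ] EuclideanSpace ℝ κ,
      IsCoordinateProjection P ∧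
      (Module.finrank ℝ (LinearMap.range P) : ℝ) ≤ δ * Fintype.card κ ∧
      360⁻¹ * δ ^ 2 * (⨅ i, |(T *ᵥ y.ofLp) i|) ≤
        (⨆ p : ι × κ, |T p.1 p.2|) * ‖y‖ / √(Fintype.card κ) +
          kthLargest (Fintype.card ι / 4) univ (fun i => |(T *ᵥ (P y).ofLp) i|) := by
  classical
  have : Nonempty ι := Fintype.card_pos_iff.1 (by lia)
  set M := ⨆ p : ι × κ, |T p.1 p.2|
  set b := ⨅ i, |(T *ᵥ y.ofLp) i|
  have hT : ∀ i j, |T i j| ≤ M := fun i j =>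
    le_ciSup (f := fun p : ι × κ => |T p.1 p.2|) (Set.finite_range _).bddAbove (i, j)
  have hM : 0 ≤ M := Real.iSup_nonneg fun _ => abs_nonneg _
  have hb : ∀ i, b ≤ |(T *ᵥ y.ofLp) i| := ciInf_le (Set.finite_range _).bddBelow
  have hb0 : 0 ≤ b := Real.iInf_nonneg fun _ => abs_nonneg _
  rcases le_or_gt (360⁻¹ * δ ^ 2 * b) (M * ‖y‖ / √(Fintype.card κ)) with hle | hlt
  · refine ⟨coordinateProjection ∅, isCoordinateProjection_coordinateProjection ∅, ?_,
      hle.trans (le_add_of_nonneg_right (le_kthLargest (by lia) ?_))⟩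
    · rw [finrank_range_coordinateProjection, card_empty, Nat.cast_zero]
      positivity
    · simpa using Nat.div_le_self _ _
  · obtain ⟨S, hScard, hS⟩ := exists_finset_card_le_many_large_mulVec hδ0 hδ1 hT hM hb hlt
    refine ⟨coordinateProjection S, isCoordinateProjection_coordinateProjection S, ?_,
      le_add_of_nonneg_of_le (by positivity) (le_kthLargest (by lia) ?_)⟩
    · rwa [finrank_range_coordinateProjection]
    · have hlarge : 360⁻¹ * δ ^ 2 * b ≤ δ * b / 15 := by
        have hδ2 : δ ^ 2 * b ≤ δ * b := by
          gcongr
          exact pow_le_of_le_one hδ0.le hδ1 two_ne_zero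
        linarith [mul_nonneg hδ0.le hb0]
      simp only [mulVec_coordinateProjection]
      refine (Nat.div_le_of_le_mul ?_).trans
        (card_le_card (monotone_filter_right _ fun i _ hi => hlarge.trans hi))
      rify
      linarith

end

theorem lemmal :
    ∃ C : ℝ, 0 < C ∧
      ∀ (δ : ℝ) (k m : ℕ), 0 < δ → δ ≤ 1 → 12 / δ ^ 2 ≤ (k : ℝ) → 4 ≤ m →
        ∀ (T : Matrix (Fin m) (Fin k) ℝ) (y : EuclideanSpace ℝ (Fin k)),
          y ∈ Metric.sphere (0 : EuclideanSpace ℝ (Fin k)) 1 →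
          ∃ P : EuclideanSpace ℝ (Fin k) →ₗ[ℝ] EuclideanSpace ℝ (Fin k),
            IsCoordinateProjection P ∧
            (Module.finrank ℝ (LinearMap.range P) : ℝ) ≤ δ * (k : ℝ) ∧
            C⁻¹ * δ ^ 2 * (⨅ l : Fin m, |(T *ᵥ y.ofLp) l|) ≤
              (⨆ p : Fin m × Fin k, |T p.1 p.2|) / √(k : ℝ) +
                kthLargest (m / 4) Finset.univ (fun l : Fin m => |(T *ᵥ (P y).ofLp) l|) :=
  ⟨360, by norm_num, fun δ k m hδ0 hδ1 _ hm T y hy => by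
    simpa only [Fintype.card_fin, mem_sphere_zero_iff_norm.1 hy, mul_one] using
      lemmal_general hδ0 hδ1 (hm.trans_eq (Fintype.card_fin m).symm) T y⟩
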